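/- Let $(V,E)$ be a rooted directed tree, that is: $V$ is a non-empty countable set, $E\subset\{(u,v)\in V\times V: u\ne v\}$, the underlying undirected graph is connected, there are no circuits (distinct vertices $v_1,\dots,v_n$, $n\ge 2$, with $(v_j,v_{j+1})\in E$ for $j<n$ and $(v_n,v_1)\in E$), every vertex $v$ has at most one parent (a vertex $u$ with $(u,v)\in E$), and there is a vertex without a parent. Put $\mathrm{Chi}(v)=\{u\in V:(v,u)\in E\}$, $\mathrm{Chi}^0(v)=\{v\}$ and $\mathrm{Chi}^{n+1}(v)=\bigcup_{u\in \mathrm{Chi}(v)}\mathrm{Chi}^{n}(u)$. Let $\mathbb K=\mathbb R$ or $\mathbb C$, let $\mu=(\mu_v)_{v\in V}$ be a family of non-zero elements of $\mathbb K$, and let $X$ be one of the following spaces: $\ell^p(V,\mu)=\{f\in\mathbb K^V:\sum_{v}|f(v)\mu_v|^p<\infty\}$, $1\le p<\infty$, with the norm $\|f\|=(\sum_v|f(v)\mu_v|^p)^{1/p}$, or $c_0(V,\mu)=\{f\in\mathbb K^V: f(v)\mu_v\to 0 \text{ along the cofinite filter of } V\}$, with the norm $\|f\|=\sup_v|f(v)\mu_v|$.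 Suppose that the backward shift $(Bf)(v)=\sum_{u\in \mathrm{Chi}(v)}f(u)$ is a bounded operator on $X$. Let $\mathcal F$ be a Furstenberg family on $\mathbb N_0=\{0,1,2,\dots\}$, i.e. a non-empty family of infinite subsets of $\mathbb N_0$ such that $A\in\mathcal F$ and $A\subset A'\subset\mathbb N_0$ imply $A'\in\mathcal F$. Let $\widetilde{\mathcal F}$ be the family of all $A\subset\mathbb N_0$ such that for every $N\in\mathbb N_0$ there is $A'\in\mathcal F$ with $(A'+\{-N,\dots,N\})\cap\mathbb N_0\subset A$. For $C,W\subset X$ put $N(C,W)=\{n\in\mathbb N_0: B^n(C)\cap W\neq\emptyset\}$. For a family $\mathcal G$ of subsets of $\mathbb N_0$, the operator $B$ is called $\mathcal G$-transitive if $N(U,W)\in\mathcal G$ for all non-empty open sets $U,W\subset X$. For $n\in\mathbb N_0$ and $v\in V$ define $\omega_n(v)\in[0,\infty]$ by $$\omega_n(v)=\begin{cases}\sup_{u\in \mathrm{Chi}^n(v)}\frac1{|\mu_u|} & \text{if } X=\ell^1(V,\mu),\\[1mm] \Big(\sum_{u\in \mathrm{Chi}^n(v)}\frac1{|\mu_u|^{p^*}}\Big)^{1/p^*}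 & \text{if } X=\ell^p(V,\mu),\ 1<p<\infty,\ p^*=\frac p{p-1},\\[1mm] \sum_{u\in \mathrm{Chi}^n(v)}\frac1{|\mu_u|} & \text{if } X=c_0(V,\mu),\end{cases}$$ where a supremum or a sum over the empty set is $0$. Then the following assertions are equivalent: (1) $B$ is $\widetilde{\mathcal F}$-transitive. (2) $B$ is $\mathcal F$-transitive. (3) There is a bounded set $C\subset X\setminus\{0\}$ such that $N(C,W)\in\mathcal F$ for every non-empty weakly open set $W\subset X$. (4) For every integer $N\ge1$ and every finite set $F\subset V$, $\ \bigcap_{v\in F}\{n\in\mathbb N_0:\omega_n(v)>N\}\in\mathcal F$ (the empty intersection being $\mathbb N_0$). If $A\cap[n,\infty)\in\mathcal F$ whenever $A\in\mathcal F$ and $n\in\mathbb N$, then (1)–(4) are also equivalent to (5) For every $g\in X$, every open set $U\ni g$ and every weakly open set $W\ni g$, $N(U,W)\in\mathcal F$. If $\mathcal F$ is a filter, i.e. $A\cap A'\in\mathcal F$ whenever $A,A'\in\mathcal F$, then (1)–(4) are also equivalent to (6) For every integer $N\ge1$ and every $v\in V$, $\ \{n\in\mathbb N_0:\omega_n(v)>N\}\in\mathcal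 F$. -/

import Mathlib

open Set Filter Topology
open scoped ENNReal

noncomputable section

namespace TreeShift

/-! ### Directed trees -/

section Trees

variable {V : Type*}

/-- A circuit: at least two distinct vertices `c 0, c 1, …, c (n+1)`, each joined by an edge to
the next one, and the last one joined by an edge to the first one. -/
def IsCircuit (G : Digraph V) {n : ℕ} (c : Fin (n + 2) → V) : Prop :=
  Function.Injective c ∧ (∀ j : Fin (n + 1), G.Adj (c j.castSucc) (c j.succ)) ∧
    G.Adj (c (Fin.last (n + 1))) (c 0)

/-- Directed trees: countable non-empty vertex set, no edge from a vertex to itself, connected as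
an undirected graph, without circuits, and every vertex has at most one parent. -/
structure IsDirectedTree (G : Digraph V) : Prop where
  nonempty : Nonempty V
  countable : Countable V
  loopless : ∀ v, ¬ G.Adj v v
  connected : ∀ u v, Relation.ReflTransGen (fun a b => G.Adj a b ∨ G.Adj b a) u v
  no_circuit : ∀ (n : ℕ) (c : Fin (n + 2) → V), ¬ IsCircuit G c
  parent_unique : ∀ u u' v, G.Adj u v → G.Adj u' v → u = u'

/-- There is a root, i.e. a vertex without a parent. -/
def IsRooted (G : Digraph V) : Prop := ∃ r, ∀ u, ¬ G.Adj u r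

/-- The children of `v`. -/
def children (G : Digraph V) (v : V) : Set V := {u | G.Adj v u}

/-- `Chi^n(v)`, the descendants of `v` in the `n`-th generation. -/
def descendants (G : Digraph V) : ℕ → V → Set V
  | 0, v => {v}
  | n + 1, v => ⋃ u ∈ children G v, descendants G n u

end Trees

/-! ### Weighted sequence spaces -/

section Spaces

variable {V 𝕜 : Type*} [RCLike 𝕜]

/-- The functions `f : V → 𝕜` with `∑ |f v * μ v| ^ p < ∞` if `p < ∞`, and those for which
`f v * μ v` tends to zero along the cofinite filter (and hence is bounded) if `p = ∞`. -/
def weightedSubmodule (μ : V → 𝕜ˣ) (p : ℝ≥0∞) : Submodule 𝕜 (V → 𝕜) where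
  carrier := {f | Memℓp (fun v => f v * (μ v : 𝕜)) p ∧
    (p = ∞ → Tendsto (fun v => f v * (μ v : 𝕜)) cofinite (𝓝 0))}
  zero_mem' := by
    constructor
    · have h : (fun v => (0 : V → 𝕜) v * (μ v : 𝕜)) = 0 := by
        funext v
        simp
      rw [h]
      exact zero_memℓp
    · intro _
      simpa using (tendsto_const_nhds : Tendsto (fun _ : V => (0 : 𝕜)) cofinite (𝓝 0))
  add_mem' := by
    rintro f g ⟨hf, hf'⟩ ⟨hg, hg'⟩
    refine ⟨?_, fun hp => ?_⟩
    · have h := hf.add hg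
      convert h using 1
      funext v
      simp [add_mul]
    · simpa [add_mul] using (hf' hp).add (hg' hp)
  smul_mem' := by
    rintro c f ⟨hf, hf'⟩
    refine ⟨?_, fun hp => ?_⟩
    · have h := hf.const_smul c
      convert h using 1
      funext v
      simp [mul_assoc]
    · simpa [mul_assoc] using (hf' hp).const_mul c

/-- The weighted sequence space over `V` with weight `μ`: it is `ℓ^p(V, μ)` if `p < ∞`, and it is
`c_0(V, μ)` (not `ℓ^∞(V, μ)`) if `p = ∞`. A separate type, so that it carries the norm topology
and not that of pointwise convergence. -/
def WeightedSpace (μ : V → 𝕜ˣ) (p : ℝ≥0∞) : Type _ := weightedSubmodule μ p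

namespace WeightedSpace

variable (μ : V → 𝕜ˣ) (p : ℝ≥0∞)

instance instAddCommGroup : AddCommGroup (WeightedSpace μ p) :=
  inferInstanceAs (AddCommGroup (weightedSubmodule μ p))

instance instModule : Module 𝕜 (WeightedSpace μ p) :=
  inferInstanceAs (Module 𝕜 (weightedSubmodule μ p))

instance instCoeFun : CoeFun (WeightedSpace μ p) (fun _ => V → 𝕜) :=
  ⟨fun f => (f : weightedSubmodule μ p).1⟩

/-- Multiplication by the weight, as a map into the unweighted space `ℓ^p(V)`. -/
def toLp : WeightedSpace μ p →ₗ[𝕜] lp (fun _ : V => 𝕜) p where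
  toFun f := ⟨fun v => f v * (μ v : 𝕜), f.2.1⟩
  map_add' f g := by
    ext v
    exact add_mul (f v) (g v) (μ v : 𝕜)
  map_smul' c f := by
    ext v
    exact mul_assoc c (f v) (μ v : 𝕜)

theorem toLp_apply (f : WeightedSpace μ p) (v : V) : toLp μ p f v = f v * (μ v : 𝕜) := rfl

theorem toLp_injective : Function.Injective (toLp μ p) := by
  intro f g h
  apply Subtype.ext
  funext v
  have hv : f v * (μ v : 𝕜) = g v * (μ v : 𝕜) := by
    rw [← toLp_apply, ← toLp_apply, h]
  exact mul_right_cancel₀ (μ v).ne_zero hv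

variable [Fact (1 ≤ p)]

/-- The norm is `‖f‖ = (∑ |f v * μ v| ^ p) ^ (1 / p)` if `p < ∞`, and
`‖f‖ = sup |f v * μ v|` if `p = ∞`. -/
instance instNormedAddCommGroup : NormedAddCommGroup (WeightedSpace μ p) :=
  NormedAddCommGroup.induced (WeightedSpace μ p) (lp (fun _ : V => 𝕜) p) (toLp μ p)
    (toLp_injective μ p)

instance instNormedSpace : NormedSpace 𝕜 (WeightedSpace μ p) :=
  NormedSpace.induced 𝕜 (WeightedSpace μ p) (lp (fun _ : V => 𝕜) p) (toLp μ p)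

theorem norm_eq_tsum (hp : p ≠ ∞) (f : WeightedSpace μ p) :
    ‖f‖ = (∑' v, ‖f v * (μ v : 𝕜)‖ ^ p.toReal) ^ (1 / p.toReal) :=
  lp.norm_eq_tsum_rpow
    (ENNReal.toReal_pos (zero_lt_one.trans_le Fact.out).ne' hp) (toLp μ p f)

theorem norm_eq_iSup (f : WeightedSpace μ ∞) : ‖f‖ = ⨆ v, ‖f v * (μ v : 𝕜)‖ :=
  lp.norm_eq_ciSup (toLp μ ∞ f)

end WeightedSpace

/-- The bounded operator `B` on the weighted space is the backward shift of the graph: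
`(B f)(v)` is the (convergent) sum of `f u` over the children `u` of `v`. -/
def IsBackwardShift (G : Digraph V) {μ : V → 𝕜ˣ} {p : ℝ≥0∞} [Fact (1 ≤ p)]
    (B : WeightedSpace μ p →L[𝕜] WeightedSpace μ p) : Prop :=
  ∀ (f : WeightedSpace μ p) (v : V), HasSum (fun u : children G v => f u) (B f v)

open Classical in
/-- The quantity attached to the `n`-th generation of descendants of `v`, with values in `[0, ∞]`:
the supremum of `1 / |μ u|` for `ℓ^1`, the number `(∑ 1 / |μ u| ^ q) ^ (1 / q)` with
`q = p / (p - 1)` for `ℓ^p`, `1 < p < ∞`, and the sum of `1 / |μ u|` for `c_0` (`p = ∞`). -/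
def generationWeight (G : Digraph V) (μ : V → 𝕜ˣ) (p : ℝ≥0∞) (n : ℕ) (v : V) : ℝ≥0∞ :=
  if p = 1 then ⨆ u ∈ descendants G n v, ‖(μ u : 𝕜)‖ₑ⁻¹
  else if p = ∞ then ∑' u : descendants G n v, ‖(μ u : 𝕜)‖ₑ⁻¹
  else (∑' u : descendants G n v, ‖(μ u : 𝕜)‖ₑ⁻¹ ^ (p.toReal / (p.toReal - 1))) ^
    (1 / (p.toReal / (p.toReal - 1)))

end Spaces

/-! ### Families of sets of natural numbers -/

/-- Furstenberg families. -/
structure IsFurstenbergFamily (F : Set (Set ℕ)) : Prop where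
  nonempty : F.Nonempty
  infinite : ∀ A ∈ F, A.Infinite
  mono : ∀ A ∈ F, ∀ B : Set ℕ, A ⊆ B → B ∈ F

/-- The family of the sets `A` such that for every `N` there is `B ∈ F` with
`(B + [-N, N]) ∩ ℕ ⊆ A`. -/
def tildeFamily (F : Set (Set ℕ)) : Set (Set ℕ) :=
  {A | ∀ N : ℕ, ∃ B ∈ F, {m : ℕ | ∃ b ∈ B, |(m : ℤ) - (b : ℤ)| ≤ (N : ℤ)} ⊆ A}

/-! ### Return sets and transitivity -/

section Dynamics

variable {𝕜 X : Type*} [RCLike 𝕜] [NormedAddCommGroup X] [NormedSpace 𝕜 X]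

/-- The return set `N(A, C)` of the operator `T`. -/
def returnSet (T : X →L[𝕜] X) (A C : Set X) : Set ℕ :=
  {n | (((T ^ n : X →L[𝕜] X) '' A) ∩ C).Nonempty}

/-- `F`-transitivity. -/
def IsFamilyTransitive (F : Set (Set ℕ)) (T : X →L[𝕜] X) : Prop :=
  ∀ U W : Set X, IsOpen U → U.Nonempty → IsOpen W → W.Nonempty → returnSet T U W ∈ F

variable (𝕜) in
/-- `W` is open for the weak topology `σ(X, X*)`. -/
def IsWeaklyOpen (W : Set X) : Prop := IsOpen ((toWeakSpace 𝕜 X).symm ⁻¹' W)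

end Dynamics

end TreeShift

end

open TreeShift

/-! Since parents are unique, `(B ^ n) f v` is the sum of `f` over `Chi^n(v)`, and Hölder duality
identifies the norm of this functional with ω_n(v). The sets `Chi^n(v)` of distinct `v` are
disjoint, so a nearly extremal, finitely supported function on `Chi^n(v)` is sent by `B ^ n` exactly
to the unit vector e_v. Thus a large ω_n(v) gives e_v a small preimage under `B ^ n`
(`IsBackwardShift.exists_pow_eq_single`); conversely, a bounded vector with a large `v`-coordinate
after `n` steps forces ω_n(v) to be large (`IsBackwardShift.le_generationWeight`).

Because of the root, high powers of `B` kill any given finitely supported vector. Under (4), take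
finitely supported f ∈ U and g ∈ W and a small h with `B ^ n` h = g: then f + h lies in U and is
mapped to g. Conversely, (3) or (5) is tested on the weakly open sets where finitely many
coordinates are large.

The passage to `tildeFamily F` takes place on the weights: ω_{n+k}(v) is at least ω_n of any vertex
in `Chi^k(v)` and at most ‖B^k‖ ω_n(v), so (4) for `F` improves itself to (4) for `tildeFamily F`
(`largeWeightSet_mem_tildeFamily`). -/

noncomputable section

namespace TreeShift

/-! ### Generations in a rooted directed tree -/

section Descendants

variable {V : Type*} {G : Digraph V}

theorem mem_descendants_succ {n : ℕ} {v u : V} :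
    u ∈ descendants G (n + 1) v ↔ ∃ x, G.Adj v x ∧ u ∈ descendants G n x := by
  simp [descendants, children]

theorem mem_descendants_add {m n : ℕ} {v u : V} :
    u ∈ descendants G (m + n) v ↔ ∃ x ∈ descendants G m v, u ∈ descendants G n x := by
  induction m generalizing v with
  | zero => simp [descendants]
  | succ m ih =>
    rw [Nat.add_right_comm]
    simp only [mem_descendants_succ, ih]
    grind

theorem mem_descendants_succ' {n : ℕ} {v u : V} :
    u ∈ descendants G (n + 1) v ↔ ∃ x ∈ descendants G n v, G.Adj x u := by
  rw [mem_descendants_add]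
  simp [descendants, children]

/-- Climbing from `u` is deterministic, so the ascent of `m + k` steps to `w` passes through `r`
after `k` steps. -/
theorem IsDirectedTree.mem_descendants_of_add (hG : IsDirectedTree G) {k m : ℕ} {r w u : V}
    (hr : u ∈ descendants G k r) (hw : u ∈ descendants G (m + k) w) :
    r ∈ descendants G m w := by
  induction k generalizing u with
  | zero =>
    have : u = r := hr
    exact this ▸ hw
  | succ k ih =>
    rw [← Nat.add_assoc] at hw
    obtain ⟨x, hx, hxu⟩ := mem_descendants_succ'.1 hr
    obtain ⟨y, hy, hyu⟩ := mem_descendants_succ'.1 hw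
    obtain rfl := hG.parent_unique _ _ _ hxu hyu
    exact ih hx hy

theorem IsDirectedTree.eq_of_mem_descendants (hG : IsDirectedTree G) {n : ℕ} {v w u : V}
    (hv : u ∈ descendants G n v) (hw : u ∈ descendants G n w) : v = w :=
  hG.mem_descendants_of_add (m := 0) hv (by rwa [Nat.zero_add])

/-- Along an undirected walk from `r` each edge raises or lowers the generation by one; it cannot be
lowered at `r`, which has no parent. -/
theorem IsDirectedTree.exists_mem_descendants_root (hG : IsDirectedTree G) {r : V}
    (hr : ∀ u, ¬ G.Adj u r) (v : V) : ∃ k, v ∈ descendants G k r := by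
  induction hG.connected r v with
  | refl => exact ⟨0, rfl⟩
  | @tail a b _ hab ih =>
    obtain ⟨k, hk⟩ := ih
    rcases hab with hab | hba
    · exact ⟨k + 1, mem_descendants_succ'.2 ⟨a, hk, hab⟩⟩
    · cases k with
      | zero =>
        have : a = r := hk
        exact absurd (this ▸ hba) (hr b)
      | succ k =>
        obtain ⟨x, hx, hxa⟩ := mem_descendants_succ'.1 hk
        exact ⟨k, hG.parent_unique _ _ _ hxa hba ▸ hx⟩

/-- In a rooted directed tree every vertex has only finitely many ancestors. -/
theorem IsDirectedTree.exists_forall_notMem_descendants (hG : IsDirectedTree G)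
    (hroot : IsRooted G) (u : V) : ∃ n₀, ∀ n, n₀ ≤ n → ∀ w, u ∉ descendants G n w := by
  obtain ⟨r, hr⟩ := hroot
  obtain ⟨k, hk⟩ := hG.exists_mem_descendants_root hr u
  refine ⟨k + 1, fun n hn w hw => ?_⟩
  obtain ⟨m, rfl⟩ := Nat.exists_eq_add_of_le hn
  have : r ∈ descendants G (m + 1) w :=
    hG.mem_descendants_of_add hk (by rwa [Nat.add_assoc, Nat.add_comm m, Nat.add_comm 1 k])
  obtain ⟨x, -, hx⟩ := mem_descendants_succ'.1 this
  exact hr x hx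

theorem descendants_nonempty_of_le {m n : ℕ} (hmn : m ≤ n) {v : V}
    (h : (descendants G n v).Nonempty) : (descendants G m v).Nonempty := by
  obtain ⟨k, rfl⟩ := Nat.exists_eq_add_of_le hmn
  obtain ⟨u, hu⟩ := h
  obtain ⟨x, hx, -⟩ := mem_descendants_add.1 hu
  exact ⟨x, hx⟩

end Descendants

/-! ### Finitely supported functions and coordinate functionals -/

namespace WeightedSpace

variable {V 𝕜 : Type*} [RCLike 𝕜] {μ : V → 𝕜ˣ} {p : ℝ≥0∞}

@[ext]
theorem ext {f g : WeightedSpace μ p} (h : ∀ v, f v = g v) : f = g :=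
  Subtype.ext (funext h)

@[simp] protected theorem sub_apply (f g : WeightedSpace μ p) (v : V) :
    (f - g) v = f v - g v := rfl

@[simp] protected theorem smul_apply (c : 𝕜) (f : WeightedSpace μ p) (v : V) :
    (c • f) v = c * f v := rfl

@[simp] protected theorem zero_apply (v : V) : (0 : WeightedSpace μ p) v = 0 := rfl

open Classical in
/-- The function with value `a` at `v` that vanishes elsewhere. -/
def single (μ : V → 𝕜ˣ) (p : ℝ≥0∞) (v : V) (a : 𝕜) : WeightedSpace μ p :=
  (⟨Pi.single v a, by
    have h : (fun w => (Pi.single v a : V → 𝕜) w * (μ w : 𝕜)) =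
        (lp.single p v (a * (μ v : 𝕜)) : lp (fun _ : V => 𝕜) p) := by
      funext w
      rw [lp.coeFn_single]
      obtain rfl | hw := eq_or_ne w v
      · simp
      · simp [hw]
    refine ⟨h ▸ lp.memℓp _, fun _ => ?_⟩
    refine tendsto_const_nhds.congr' ?_
    filter_upwards [(finite_singleton v).compl_mem_cofinite] with w hw
    have hw : w ≠ v := hw
    simp [hw]⟩ : weightedSubmodule μ p)

@[simp] theorem single_self (v : V) (a : 𝕜) : single μ p v a v = a := by
  classical exact Pi.single_eq_same (M := fun _ : V => 𝕜) v a

theorem single_of_ne {v w : V} (h : w ≠ v) (a : 𝕜) : single μ p v a w = 0 := by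
  classical exact Pi.single_eq_of_ne (M := fun _ : V => 𝕜) h a

theorem smul_single_one (v : V) (a : 𝕜) : a • single μ p v 1 = single μ p v a := by
  ext w
  rw [WeightedSpace.smul_apply]
  obtain rfl | h := eq_or_ne w v
  · simp
  · simp [single_of_ne h]

open Classical in
theorem toLp_single (v : V) (a : 𝕜) :
    toLp μ p (single μ p v a) = lp.single p v (a * (μ v : 𝕜)) := by
  ext w
  rw [toLp_apply, lp.single_apply]
  obtain rfl | h := eq_or_ne w v
  · simp
  · simp [single_of_ne h, h]

variable [Fact (1 ≤ p)]

theorem norm_toLp (f : WeightedSpace μ p) : ‖toLp μ p f‖ = ‖f‖ := rfl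

theorem isometry_toLp : Isometry (toLp μ p) :=
  AddMonoidHomClass.isometry_of_norm _ norm_toLp

theorem norm_apply_mul_le (f : WeightedSpace μ p) (v : V) : ‖f v * (μ v : 𝕜)‖ ≤ ‖f‖ :=
  lp.norm_apply_le_norm (zero_lt_one.trans_le Fact.out).ne' (toLp μ p f) v

/-- Evaluation at a vertex, as a continuous linear functional. -/
def evalCLM (μ : V → 𝕜ˣ) (p : ℝ≥0∞) [Fact (1 ≤ p)] (v : V) : WeightedSpace μ p →L[𝕜] 𝕜 :=
  LinearMap.mkContinuous
    { toFun := fun f => f v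
      map_add' := fun _ _ => rfl
      map_smul' := fun _ _ => rfl } ‖(μ v : 𝕜)‖⁻¹ fun f => by
    have h := norm_apply_mul_le f v
    rw [norm_mul] at h
    rw [inv_mul_eq_div]
    exact (le_div_iff₀ (norm_pos_iff.2 (μ v).ne_zero)).2 h

@[simp] theorem evalCLM_apply (v : V) (f : WeightedSpace μ p) : evalCLM μ p v f = f v := rfl

@[simp] protected theorem sum_apply {ι : Type*} (s : Finset ι) (f : ι → WeightedSpace μ p) (v : V) :
    (∑ i ∈ s, f i) v = ∑ i ∈ s, f i v := by
  exact map_sum (evalCLM μ p v) f s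

theorem norm_le_of_forall_le {f : WeightedSpace μ ∞} {C : ℝ} (hC : 0 ≤ C)
    (h : ∀ v, ‖f v * (μ v : 𝕜)‖ ≤ C) : ‖f‖ ≤ C :=
  lp.norm_le_of_forall_le (f := toLp μ ∞ f) hC h

theorem norm_single (v : V) (a : 𝕜) : ‖single μ p v a‖ = ‖a‖ * ‖(μ v : 𝕜)‖ := by
  classical
  rw [← norm_toLp, toLp_single, lp.norm_single (zero_lt_one.trans_le Fact.out), norm_mul]

open Classical in
theorem sum_single_apply (s : Finset V) (c : V → 𝕜) (v : V) :
    (∑ u ∈ s, single μ p u (c u)) v = if v ∈ s then c v else 0 := by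
  rw [WeightedSpace.sum_apply]
  split_ifs with h
  · rw [Finset.sum_eq_single_of_mem v h fun u _ hu => single_of_ne hu.symm _, single_self]
  · exact Finset.sum_eq_zero fun u hu => single_of_ne (by grind) _

theorem norm_sum_single_rpow (hp : p ≠ ∞) (s : Finset V) (c : V → 𝕜) :
    ‖∑ u ∈ s, single μ p u (c u)‖ ^ p.toReal = ∑ u ∈ s, (‖c u‖ * ‖(μ u : 𝕜)‖) ^ p.toReal := by
  classical
  have hp₀ : 0 < p.toReal := ENNReal.toReal_pos (zero_lt_one.trans_le Fact.out).ne' hp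
  simp_rw [← norm_toLp, map_sum, toLp_single, ← norm_mul]
  exact lp.norm_sum_single hp₀ (fun u => c u * (μ u : 𝕜)) s

/-- The finitely supported approximations to an element of the space converge to it. -/
theorem hasSum_single (f : WeightedSpace μ p) : HasSum (fun v => single μ p v (f v)) f := by
  classical
  by_cases hp : p = ∞
  · subst hp
    rw [HasSum, Metric.tendsto_nhds]
    intro ε hε
    -- Decay at infinity is what separates c_0 from ℓ^∞. The supremum only inherits `≤`, hence `ε /
    -- 2`.
    have hfin : {v | ¬ ‖f v * (μ v : 𝕜)‖ < ε / 2}.Finite := by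
      have := (f.2.2 rfl).norm
      rw [norm_zero] at this
      exact this.eventually (gt_mem_nhds (half_pos hε))
    simp only [SummationFilter.unconditional_filter]
    filter_upwards [eventually_ge_atTop hfin.toFinset] with s hs
    rw [dist_eq_norm]
    refine (norm_le_of_forall_le (half_pos hε).le fun v => ?_).trans_lt (half_lt_self hε)
    rw [WeightedSpace.sub_apply, sum_single_apply]
    split_ifs with h
    · simpa using (half_pos hε).le
    · have hv : v ∉ hfin.toFinset := fun h' => h (hs h')
      have hv : ‖f v * (μ v : 𝕜)‖ < ε / 2 := by simpa using hv
      simpa using hv.le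
  · rw [← (isometry_toLp (μ := μ) (p := p)).isEmbedding.isInducing.hasSum_iff]
    convert lp.hasSum_single hp (toLp μ p f) using 1
    funext v
    exact toLp_single v (f v)

theorem exists_sum_single_mem {U : Set (WeightedSpace μ p)} (hU : IsOpen U) (hne : U.Nonempty) :
    ∃ (s : Finset V) (c : V → 𝕜), ∑ u ∈ s, single μ p u (c u) ∈ U := by
  obtain ⟨f, hf⟩ := hne
  obtain ⟨s, hs⟩ := ((hasSum_single f).eventually (hU.mem_nhds hf)).exists
  exact ⟨s, f, hs⟩

end WeightedSpace

theorem _root_.ENNReal.exists_lt_sum_of_lt_tsum_subtype {V : Type*} {S : Set V} {g : V → ℝ≥0∞}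
    {K : ℝ≥0∞} (h : K < ∑' u : S, g u) :
    ∃ t : Finset V, (t : Set V) ⊆ S ∧ K < ∑ u ∈ t, g u := by
  rw [ENNReal.tsum_eq_iSup_sum, lt_iSup_iff] at h
  obtain ⟨t, ht⟩ := h
  refine ⟨t.map (Function.Embedding.subtype _), ?_, ?_⟩
  · intro u hu
    simp only [Finset.coe_map, mem_image] at hu
    obtain ⟨x, -, rfl⟩ := hu
    exact x.2
  · simpa using ht

theorem _root_.ENNReal.sum_le_tsum_subtype {V : Type*} {S : Set V} (g : V → ℝ≥0∞)
    {t : Finset V} (ht : (t : Set V) ⊆ S) : ∑ u ∈ t, g u ≤ ∑' u : S, g u := by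
  classical
  rw [tsum_subtype]
  refine le_trans (Finset.sum_le_sum fun u hu => ?_) (ENNReal.sum_le_tsum t)
  rw [indicator_of_mem (ht hu)]

/-! ### Norms of summation functionals -/

section Duality

variable {V 𝕜 : Type*} [RCLike 𝕜]

open Classical in
/-- The norm of the functional `f ↦ ∑ u ∈ S, f u`, for an arbitrary set `S` of vertices. -/
def sumNorm (μ : V → 𝕜ˣ) (p : ℝ≥0∞) (S : Set V) : ℝ≥0∞ :=
  if p = 1 then ⨆ u ∈ S, ‖(μ u : 𝕜)‖ₑ⁻¹
  else if p = ∞ then ∑' u : S, ‖(μ u : 𝕜)‖ₑ⁻¹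
  else (∑' u : S, ‖(μ u : 𝕜)‖ₑ⁻¹ ^ (p.toReal / (p.toReal - 1))) ^
    (1 / (p.toReal / (p.toReal - 1)))

theorem generationWeight_eq_sumNorm (G : Digraph V) (μ : V → 𝕜ˣ) (p : ℝ≥0∞) (n : ℕ) (v : V) :
    generationWeight G μ p n v = sumNorm μ p (descendants G n v) := rfl

variable {μ : V → 𝕜ˣ} {p : ℝ≥0∞}

/-- At `p = 1` and `p = ∞` division by zero makes the expression `0`, so no endpoint has to be
excluded. -/
theorem one_div_conjExponent_nonneg (hp : 1 ≤ p) :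
    0 ≤ 1 / (p.toReal / (p.toReal - 1)) := by
  obtain rfl | hp' := eq_or_ne p ∞
  · simp
  · have : 1 ≤ p.toReal := by
      rw [← ENNReal.toReal_one]
      exact ENNReal.toReal_mono hp' hp
    exact one_div_nonneg.2 (div_nonneg (by linarith) (by linarith))

theorem sumNorm_mono [hp : Fact (1 ≤ p)] {S T : Set V} (h : S ⊆ T) :
    sumNorm μ p S ≤ sumNorm μ p T := by
  unfold sumNorm
  split_ifs
  · exact biSup_mono h
  · exact ENNReal.tsum_mono_subtype (fun u => ‖(μ u : 𝕜)‖ₑ⁻¹) h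
  · exact ENNReal.rpow_le_rpow (ENNReal.tsum_mono_subtype
      (fun u => ‖(μ u : 𝕜)‖ₑ⁻¹ ^ (p.toReal / (p.toReal - 1))) h)
      (one_div_conjExponent_nonneg hp.out)

namespace WeightedSpace

theorem enorm_apply_eq (f : WeightedSpace μ p) (v : V) :
    ‖f v‖ₑ = ‖(μ v : 𝕜)‖ₑ⁻¹ * ‖f v * (μ v : 𝕜)‖ₑ := by
  have h₀ : ‖(μ v : 𝕜)‖ₑ ≠ 0 := by simp
  rw [enorm_mul, mul_comm ‖f v‖ₑ, ← mul_assoc, ENNReal.inv_mul_cancel h₀ enorm_ne_top, one_mul]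

variable [Fact (1 ≤ p)]

theorem enorm_apply_mul_le (f : WeightedSpace μ p) (v : V) :
    ‖f v * (μ v : 𝕜)‖ₑ ≤ ‖f‖ₑ := by
  rw [← ofReal_norm, ← ofReal_norm]
  exact ENNReal.ofReal_le_ofReal (norm_apply_mul_le f v)

theorem sum_enorm_rpow_le (hp : p ≠ ∞) (f : WeightedSpace μ p) (t : Finset V) :
    (∑ u ∈ t, ‖f u * (μ u : 𝕜)‖ₑ ^ p.toReal) ^ (1 / p.toReal) ≤ ‖f‖ₑ := by
  have hp₀ : 0 < p.toReal := ENNReal.toReal_pos (zero_lt_one.trans_le Fact.out).ne' hp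
  rw [one_div, ENNReal.rpow_inv_le_iff hp₀]
  simp_rw [← ofReal_norm, ENNReal.ofReal_rpow_of_nonneg (norm_nonneg _) hp₀.le]
  rw [← ENNReal.ofReal_sum_of_nonneg fun u _ => by positivity]
  exact ENNReal.ofReal_le_ofReal (lp.sum_rpow_le_norm_rpow hp₀ (toLp μ p f) t)

end WeightedSpace

open WeightedSpace

variable [Fact (1 ≤ p)]

theorem holderConjugate_toReal (h1 : p ≠ 1) (hp : p ≠ ∞) :
    (p.toReal / (p.toReal - 1)).HolderConjugate p.toReal := by
  have h : (1 : ℝ) < p.toReal := by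
    rw [← ENNReal.toReal_one]
    exact (ENNReal.toReal_lt_toReal ENNReal.one_ne_top hp).2 (lt_of_le_of_ne Fact.out h1.symm)
  exact (Real.HolderConjugate.conjExponent h).symm

theorem sumNorm_empty : sumNorm μ p ∅ = 0 := by
  unfold sumNorm
  split_ifs with h1 hp
  · simp
  · simp
  · have hq := (holderConjugate_toReal h1 hp).pos
    rw [tsum_empty, ENNReal.zero_rpow_of_pos (one_div_pos.2 hq)]

/-- Hölder's inequality for the factorization of `f u` into `(μ u)⁻¹` and `f u * μ u`. -/
theorem sum_enorm_le_sumNorm_mul (f : WeightedSpace μ p) {S : Set V} {t : Finset V}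
    (ht : (t : Set V) ⊆ S) : ∑ u ∈ t, ‖f u‖ₑ ≤ sumNorm μ p S * ‖f‖ₑ := by
  simp_rw [enorm_apply_eq f]
  unfold sumNorm
  split_ifs with h1 hp
  · subst h1
    calc ∑ u ∈ t, ‖(μ u : 𝕜)‖ₑ⁻¹ * ‖f u * (μ u : 𝕜)‖ₑ
        ≤ ∑ u ∈ t, (⨆ u ∈ S, ‖(μ u : 𝕜)‖ₑ⁻¹) * ‖f u * (μ u : 𝕜)‖ₑ := by
          gcongr with u hu
          exact le_iSup₂ (f := fun u (_ : u ∈ S) => ‖(μ u : 𝕜)‖ₑ⁻¹) u (ht hu)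
      _ ≤ _ := by
          rw [← Finset.mul_sum]
          gcongr
          simpa using sum_enorm_rpow_le ENNReal.one_ne_top f t
  · calc ∑ u ∈ t, ‖(μ u : 𝕜)‖ₑ⁻¹ * ‖f u * (μ u : 𝕜)‖ₑ
        ≤ ∑ u ∈ t, ‖(μ u : 𝕜)‖ₑ⁻¹ * ‖f‖ₑ := by
          gcongr with u hu
          exact enorm_apply_mul_le f u
      _ ≤ _ := by
          rw [← Finset.sum_mul]
          gcongr
          exact ENNReal.sum_le_tsum_subtype (fun u => ‖(μ u : 𝕜)‖ₑ⁻¹) ht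
  · have hq := holderConjugate_toReal h1 hp
    refine (ENNReal.inner_le_Lp_mul_Lq t _ _ hq).trans ?_
    refine mul_le_mul' (ENNReal.rpow_le_rpow ?_ (one_div_nonneg.2 hq.nonneg))
      (sum_enorm_rpow_le hp f t)
    exact ENNReal.sum_le_tsum_subtype
      (fun u => ‖(μ u : 𝕜)‖ₑ⁻¹ ^ (p.toReal / (p.toReal - 1))) ht

theorem enorm_le_sumNorm_mul (f : WeightedSpace μ p) {S : Set V} {c : 𝕜}
    (hc : HasSum (S.indicator f) c) : ‖c‖ₑ ≤ sumNorm μ p S * ‖f‖ₑ := by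
  classical
  refine le_of_tendsto' hc.enorm fun s => ?_
  calc ‖∑ u ∈ s, S.indicator f u‖ₑ
      = ‖∑ u ∈ s with u ∈ S, f u‖ₑ := by
        simp only [indicator_apply, Finset.sum_filter]
    _ ≤ ∑ u ∈ s with u ∈ S, ‖f u‖ₑ := enorm_sum_le _ _
    _ ≤ _ := sum_enorm_le_sumNorm_mul f (by intro u; simp)

theorem ofReal_inv_norm_units (x : 𝕜ˣ) : ‖(x : 𝕜)‖ₑ⁻¹ = ENNReal.ofReal ‖(x : 𝕜)‖⁻¹ := by
  rw [ENNReal.ofReal_inv_of_pos (norm_pos_iff.2 x.ne_zero), ofReal_norm]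

/-- `sumNorm μ p S` is attained approximately at finitely supported functions on `S`. -/
theorem exists_sum_eq_one_of_lt_sumNorm {S : Set V} {K : ℝ} (hK : 0 ≤ K)
    (h : ENNReal.ofReal K < sumNorm μ p S) :
    ∃ (t : Finset V) (c : V → 𝕜), (t : Set V) ⊆ S ∧ ∑ u ∈ t, c u = 1 ∧
      K * ‖∑ u ∈ t, single μ p u (c u)‖ ≤ 1 := by
  have hμ : ∀ u, 0 < ‖(μ u : 𝕜)‖ := fun u => norm_pos_iff.2 (μ u).ne_zero
  unfold sumNorm at h
  split_ifs at h with h1 hp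
  · simp only [lt_iSup_iff] at h
    obtain ⟨u, hu, h⟩ := h
    refine ⟨{u}, fun _ => 1, by simpa using hu, by simp, ?_⟩
    rw [ofReal_inv_norm_units] at h
    have := (ENNReal.ofReal_lt_ofReal_iff_of_nonneg hK).1 h
    rw [Finset.sum_singleton, norm_single, norm_one, one_mul]
    exact ((lt_inv_mul_iff₀ (hμ u)).1 (by simpa using this)).le.trans' (mul_comm _ _).le
  · subst hp
    obtain ⟨t, ht, h⟩ := ENNReal.exists_lt_sum_of_lt_tsum_subtype
      (g := fun u => ‖(μ u : 𝕜)‖ₑ⁻¹) h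
    simp_rw [ofReal_inv_norm_units] at h
    rw [← ENNReal.ofReal_sum_of_nonneg fun u _ => by positivity,
      ENNReal.ofReal_lt_ofReal_iff_of_nonneg hK] at h
    set A := ∑ u ∈ t, ‖(μ u : 𝕜)‖⁻¹ with hA
    have hA₀ : 0 < A := hK.trans_lt h
    -- This choice makes `|c u * μ u|` constant on `t`, equal to `A⁻¹`.
    refine ⟨t, fun u => ((‖(μ u : 𝕜)‖⁻¹ / A : ℝ) : 𝕜), ht, ?_, ?_⟩
    · rw [← RCLike.ofReal_sum, ← Finset.sum_div, ← hA, div_self hA₀.ne', RCLike.ofReal_one]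
    · have hle : ‖∑ u ∈ t, single μ ∞ u ((‖(μ u : 𝕜)‖⁻¹ / A : ℝ) : 𝕜)‖ ≤ A⁻¹ := by
        refine norm_le_of_forall_le (by positivity) fun v => ?_
        classical
        rw [sum_single_apply t (fun u => ((‖(μ u : 𝕜)‖⁻¹ / A : ℝ) : 𝕜))]
        split_ifs with hv
        · have := (hμ v).ne'
          rw [norm_mul, RCLike.norm_of_nonneg (by positivity)]
          apply le_of_eq
          field_simp
        · simpa using hA₀.le
      calc K * _ ≤ A * A⁻¹ := mul_le_mul h.le hle (norm_nonneg _) hA₀.le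
        _ = 1 := mul_inv_cancel₀ hA₀.ne'
  · have hq := holderConjugate_toReal h1 hp
    set q := p.toReal / (p.toReal - 1)
    set r := p.toReal
    rw [one_div, ENNReal.lt_rpow_inv_iff hq.pos, ENNReal.ofReal_rpow_of_nonneg hK hq.nonneg] at h
    obtain ⟨t, ht, h⟩ := ENNReal.exists_lt_sum_of_lt_tsum_subtype
      (g := fun u => ‖(μ u : 𝕜)‖ₑ⁻¹ ^ q) h
    simp_rw [ofReal_inv_norm_units,
      ENNReal.ofReal_rpow_of_nonneg (inv_nonneg.2 (norm_nonneg _)) hq.nonneg] at h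
    rw [← ENNReal.ofReal_sum_of_nonneg fun u _ => by positivity,
      ENNReal.ofReal_lt_ofReal_iff_of_nonneg (by positivity)] at h
    set A := ∑ u ∈ t, ‖(μ u : 𝕜)‖⁻¹ ^ q with hA
    have hA₀ : 0 < A := lt_of_le_of_lt (by positivity) h
    -- The equality case of Hölder: `|c u * μ u| ^ r` is proportional to `|μ u| ^ (-q)`, because `(q
    -- - 1) * r = q`.
    refine ⟨t, fun u => ((‖(μ u : 𝕜)‖⁻¹ ^ q / A : ℝ) : 𝕜), ht, ?_, ?_⟩
    · rw [← RCLike.ofReal_sum, ← Finset.sum_div, ← hA, div_self hA₀.ne', RCLike.ofReal_one]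
    · have hterm : ∀ u, (‖((‖(μ u : 𝕜)‖⁻¹ ^ q / A : ℝ) : 𝕜)‖ * ‖(μ u : 𝕜)‖) ^ r =
          ‖(μ u : 𝕜)‖⁻¹ ^ q / A ^ r := by
        intro u
        rw [RCLike.norm_of_nonneg (by positivity), div_mul_eq_mul_div,
          Real.div_rpow (by positivity) hA₀.le]
        congr 1
        have hx : ‖(μ u : 𝕜)‖ = ‖(μ u : 𝕜)‖⁻¹ ^ (-1 : ℝ) := by
          rw [Real.rpow_neg_one, inv_inv]
        nth_rewrite 2 [hx]
        rw [← Real.rpow_add (inv_pos.2 (hμ u)), ← Real.rpow_mul (by positivity)]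
        congr 1
        have := hq.mul_eq_add
        linarith
      have hnorm := norm_sum_single_rpow (μ := μ) hp t
        (fun u => ((‖(μ u : 𝕜)‖⁻¹ ^ q / A : ℝ) : 𝕜))
      rw [Finset.sum_congr rfl fun u _ => hterm u, ← Finset.sum_div, ← hA] at hnorm
      have hr : 0 < r := hq.symm.pos
      -- After taking `r`-th powers the claim is `K ^ r * A ≤ A ^ r`, which follows from `K ^ q < A`
      -- and `r / q + 1 = r`.
      rw [← Real.rpow_le_rpow_iff (by positivity) zero_le_one hr, Real.one_rpow,
        Real.mul_rpow hK (norm_nonneg _), hnorm, ← mul_div_assoc, div_le_one (by positivity)]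
      have hKr : K ^ r ≤ A ^ (r / q) := by
        have := Real.rpow_le_rpow (by positivity) h.le (div_nonneg hr.le hq.nonneg)
        rwa [← Real.rpow_mul hK, mul_div_cancel₀ _ hq.pos.ne'] at this
      calc K ^ r * A ≤ A ^ (r / q) * A ^ (1 : ℝ) := by
            rw [Real.rpow_one]
            gcongr
        _ = A ^ r := by
            rw [← Real.rpow_add hA₀]
            congr 1
            have := hq.pos.ne'
            field_simp
            linarith [hq.mul_eq_add]

end Duality

/-! ### Weakly open sets -/

section WeakTopology

variable {𝕜 X : Type*} [RCLike 𝕜] [NormedAddCommGroup X] [NormedSpace 𝕜 X]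

theorem IsWeaklyOpen.isOpen {W : Set X} (hW : IsWeaklyOpen 𝕜 W) : IsOpen W :=
  IsOpen.preimage (toWeakSpaceCLM 𝕜 X).continuous hW

theorem isWeaklyOpen_setOf_forall_lt_norm {ι : Type*} (S : Finset ι) (φ : ι → X →L[𝕜] 𝕜)
    (K : ℝ) : IsWeaklyOpen 𝕜 {f | ∀ v ∈ S, K < ‖φ v f‖} := by
  have h : {f | ∀ v ∈ S, K < ‖φ v f‖} = ⋂ v ∈ S, {f | K < ‖φ v f‖} := by
    ext f
    simp
  rw [IsWeaklyOpen, h]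
  simp only [preimage_iInter]
  refine isOpen_biInter_finset fun v _ => ?_
  exact isOpen_lt continuous_const
    (WeakBilin.eval_continuous (topDualPairing 𝕜 X).flip (φ v)).norm

end WeakTopology

/-! ### Powers of the backward shift and generation weights -/

section Shift

open WeightedSpace

variable {V 𝕜 : Type*} [RCLike 𝕜] {G : Digraph V} {μ : V → 𝕜ˣ} {p : ℝ≥0∞} [Fact (1 ≤ p)]
  {B : WeightedSpace μ p →L[𝕜] WeightedSpace μ p}

open Classical in
-- At most one child of `v` can have `u` in its `n`-th generation, so the defining series of `B` has
-- at most one non-zero term.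
theorem IsBackwardShift.pow_single_apply (hG : IsDirectedTree G) (hB : IsBackwardShift G B)
    (n : ℕ) (u v : V) (a : 𝕜) :
    ((B ^ n) (single μ p u a)) v = if u ∈ descendants G n v then a else 0 := by
  induction n generalizing v with
  | zero =>
    by_cases h : u = v
    · subst h
      simp [descendants]
    · simp [descendants, h, single_of_ne (Ne.symm h)]
  | succ n ih =>
    have hsum := hB ((B ^ n) (single μ p u a)) v
    have hpow : (B ^ (n + 1)) (single μ p u a) = B ((B ^ n) (single μ p u a)) := by
      rw [pow_succ']
      rfl
    rw [hpow]
    refine hsum.unique ?_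
    simp_rw [ih]
    split_ifs with h
    · obtain ⟨x, hx, hux⟩ := mem_descendants_succ.1 h
      convert hasSum_single (α := 𝕜) (⟨x, hx⟩ : children G v) ?_ using 1
      · rw [if_pos hux]
      · intro y hy
        rw [if_neg]
        exact fun huy => hy (Subtype.ext (hG.eq_of_mem_descendants huy hux))
    · convert (hasSum_zero : HasSum (fun _ : children G v => (0 : 𝕜)) 0) using 2 with y
      exact if_neg fun hy => h (mem_descendants_succ.2 ⟨y, y.2, hy⟩)

/-- Applying a continuous functional to the expansion of `f` in unit vectors avoids rearranging
iterated series over children. -/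
theorem IsBackwardShift.hasSum_pow (hG : IsDirectedTree G) (hB : IsBackwardShift G B)
    (n : ℕ) (f : WeightedSpace μ p) (v : V) :
    HasSum ((descendants G n v).indicator f) ((B ^ n) f v) := by
  classical
  have h := (WeightedSpace.hasSum_single f).mapL (evalCLM μ p v ∘L B ^ n)
  simp only [ContinuousLinearMap.comp_apply, evalCLM_apply, hB.pow_single_apply hG] at h
  simpa only [← indicator_apply] using h

theorem IsBackwardShift.enorm_pow_apply_le (hG : IsDirectedTree G) (hB : IsBackwardShift G B)
    (n : ℕ) (f : WeightedSpace μ p) (v : V) :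
    ‖(B ^ n) f v‖ₑ ≤ generationWeight G μ p n v * ‖f‖ₑ :=
  enorm_le_sumNorm_mul f (hB.hasSum_pow hG n f v)

theorem IsBackwardShift.le_generationWeight (hG : IsDirectedTree G) (hB : IsBackwardShift G B)
    {n : ℕ} {f : WeightedSpace μ p} {v : V} {N : ℝ} (h₀ : (B ^ n) f v ≠ 0)
    (h : N * ‖f‖ ≤ ‖(B ^ n) f v‖) : ENNReal.ofReal N ≤ generationWeight G μ p n v := by
  have hf : ‖f‖ₑ ≠ 0 := by
    rw [Ne, enorm_eq_zero]
    rintro rfl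
    exact h₀ (by rw [map_zero, WeightedSpace.zero_apply])
  refine (ENNReal.mul_le_mul_iff_left hf enorm_ne_top).1 ?_
  refine le_trans ?_ (hB.enorm_pow_apply_le hG n f v)
  rw [← ofReal_norm f, ← ENNReal.ofReal_mul' (norm_nonneg f), ← ofReal_norm ((B ^ n) f v)]
  exact ENNReal.ofReal_le_ofReal h

/-- If the weight of the `n`-th generation is large then `single v 1` has a preimage under `B ^ n`
of small norm. -/
theorem IsBackwardShift.exists_pow_eq_single (hG : IsDirectedTree G) (hB : IsBackwardShift G B)
    {n : ℕ} {v : V} {K : ℝ} (hK : 0 ≤ K) (h : ENNReal.ofReal K < generationWeight G μ p n v) :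
    ∃ f : WeightedSpace μ p, (B ^ n) f = single μ p v 1 ∧ K * ‖f‖ ≤ 1 := by
  classical
  obtain ⟨t, c, ht, hc, hle⟩ := exists_sum_eq_one_of_lt_sumNorm hK h
  refine ⟨_, ?_, hle⟩
  ext w
  rw [map_sum, WeightedSpace.sum_apply]
  simp_rw [hB.pow_single_apply hG]
  obtain rfl | hw := eq_or_ne w v
  · rw [single_self, ← hc]
    exact Finset.sum_congr rfl fun u hu => if_pos (ht hu)
  · rw [single_of_ne hw]
    -- Generations of distinct vertices are disjoint, so `B ^ n` leaves nothing outside `v`.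
    exact Finset.sum_eq_zero fun u hu =>
      if_neg fun hu' => hw (hG.eq_of_mem_descendants hu' (ht hu))

/-- An infinite weight would give e_v preimages of arbitrarily small norm, against the continuity of
`B ^ n`. -/
theorem IsBackwardShift.generationWeight_ne_top (hG : IsDirectedTree G)
    (hB : IsBackwardShift G B) (n : ℕ) (v : V) : generationWeight G μ p n v ≠ ∞ := by
  intro htop
  set M := ‖evalCLM μ p v ∘L B ^ n‖
  obtain ⟨f, hf, hle⟩ := hB.exists_pow_eq_single hG (n := n) (v := v) (K := M + 1)
    (by positivity) (htop ▸ ENNReal.ofReal_lt_top)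
  have h1 : ‖(evalCLM μ p v ∘L B ^ n) f‖ ≤ M * ‖f‖ := ContinuousLinearMap.le_opNorm _ _
  rw [ContinuousLinearMap.comp_apply, hf, evalCLM_apply, single_self, norm_one] at h1
  have hf0 : ‖f‖ = 0 := le_antisymm (by linarith) (norm_nonneg f)
  rw [hf0] at h1
  linarith

theorem generationWeight_le_add {k : ℕ} {u v : V} (hu : u ∈ descendants G k v) (n : ℕ) :
    generationWeight G μ p n u ≤ generationWeight G μ p (n + k) v :=
  sumNorm_mono fun x hx => by
    rw [Nat.add_comm]
    exact mem_descendants_add.2 ⟨u, hu, hx⟩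

theorem descendants_nonempty_of_generationWeight_pos {n : ℕ} {v : V}
    (h : 0 < generationWeight G μ p n v) : (descendants G n v).Nonempty := by
  rw [nonempty_iff_ne_empty]
  intro hempty
  rw [generationWeight_eq_sumNorm, hempty, sumNorm_empty] at h
  exact h.false

/-- `B ^ k` turns a small preimage of e_v under `B ^ (n + k)` into a preimage under `B ^ n`, at the
cost of a factor `M`. -/
theorem IsBackwardShift.le_generationWeight_of_lt_add (hG : IsDirectedTree G)
    (hB : IsBackwardShift G B) {k n : ℕ} {v : V} {K M : ℝ} (hK : 0 ≤ K) (hM : ‖B ^ k‖ ≤ M)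
    (h : ENNReal.ofReal (K * M) < generationWeight G μ p (n + k) v) :
    ENNReal.ofReal K ≤ generationWeight G μ p n v := by
  have hM₀ : 0 ≤ M := (norm_nonneg _).trans hM
  obtain ⟨f, hf, hle⟩ := hB.exists_pow_eq_single hG (mul_nonneg hK hM₀) h
  rw [pow_add, mul_apply_eq_comp] at hf
  refine hB.le_generationWeight hG (f := (B ^ k) f) ?_ ?_
  · rw [hf, single_self]
    exact one_ne_zero
  · rw [hf, single_self, norm_one]
    refine le_trans ?_ hle
    rw [mul_assoc]
    gcongr
    exact ((B ^ k).le_opNorm f).trans (by gcongr)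

theorem IsBackwardShift.exists_pow_eq_zero (hG : IsDirectedTree G) (hroot : IsRooted G)
    (hB : IsBackwardShift G B) (s : Finset V) (c : V → 𝕜) :
    ∃ n₀, ∀ n, n₀ ≤ n → (B ^ n) (∑ u ∈ s, single μ p u (c u)) = 0 := by
  classical
  choose m hm using hG.exists_forall_notMem_descendants hroot
  refine ⟨s.sup m, fun n hn => ?_⟩
  rw [map_sum]
  refine Finset.sum_eq_zero fun u hu => ?_
  ext w
  rw [hB.pow_single_apply hG, if_neg (hm u n ((Finset.le_sup hu).trans hn) w),
    WeightedSpace.zero_apply]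

end Shift

theorem mem_tildeFamily_of_subset {F : Set (Set ℕ)} {A A' : Set ℕ} (hA : A ∈ tildeFamily F)
    (h : A ⊆ A') : A' ∈ tildeFamily F := fun N =>
  let ⟨D, hD, hDA⟩ := hA N
  ⟨D, hD, hDA.trans h⟩

theorem IsFurstenbergFamily.tildeFamily_subset {F : Set (Set ℕ)} (hF : IsFurstenbergFamily F) :
    tildeFamily F ⊆ F := by
  intro A hA
  obtain ⟨D, hD, hDA⟩ := hA 0
  exact hF.mono D hD A fun b hb => hDA ⟨b, hb, by simp⟩

/-! ### From large weights to transitivity and back -/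

section Transitivity

open WeightedSpace

variable {V 𝕜 : Type*} [RCLike 𝕜] {G : Digraph V} {μ : V → 𝕜ˣ} {p : ℝ≥0∞} {F : Set (Set ℕ)}

/-- The set of generations whose weights exceed `N` at all vertices in `S`. -/
def largeWeightSet (G : Digraph V) (μ : V → 𝕜ˣ) (p : ℝ≥0∞) (N : ℕ) (S : Finset V) : Set ℕ :=
  ⋂ v ∈ S, {n : ℕ | (N : ℝ≥0∞) < generationWeight G μ p n v}

theorem mem_largeWeightSet {N n : ℕ} {S : Finset V} :
    n ∈ largeWeightSet G μ p N S ↔ ∀ v ∈ S, (N : ℝ≥0∞) < generationWeight G μ p n v := by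
  simp [largeWeightSet]

theorem largeWeightSet_mem_of_inter_mem (hF : IsFurstenbergFamily F)
    (hinter : ∀ A ∈ F, ∀ A' ∈ F, A ∩ A' ∈ F) {N : ℕ}
    (h : ∀ v : V, {n : ℕ | (N : ℝ≥0∞) < generationWeight G μ p n v} ∈ F) (S : Finset V) :
    largeWeightSet G μ p N S ∈ F := by
  classical
  induction S using Finset.induction_on with
  | empty =>
    obtain ⟨A, hA⟩ := hF.nonempty
    exact hF.mono A hA _ (by simp [largeWeightSet])
  | insert v S _ ih =>
    rw [largeWeightSet, Finset.set_biInter_insert]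
    exact hinter _ (h v) _ ih

variable [Fact (1 ≤ p)] {B : WeightedSpace μ p →L[𝕜] WeightedSpace μ p}

theorem natCast_lt_of_ofReal_add_one_le {N : ℕ} {a : ℝ≥0∞}
    (h : ENNReal.ofReal ((N : ℝ) + 1) ≤ a) : (N : ℝ≥0∞) < a := by
  refine lt_of_lt_of_le ?_ h
  rw [← ENNReal.ofReal_natCast]
  exact (ENNReal.ofReal_lt_ofReal_iff (by positivity)).2 (lt_add_one _)

/-- Enlarging `S` by a descendant of each `v` in each generation up to `L` controls the times after
`b`; enlarging `N` by a bound for the norms `‖B ^ k‖` controls those before. -/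
theorem largeWeightSet_mem_tildeFamily (hG : IsDirectedTree G) (hB : IsBackwardShift G B)
    (hF : IsFurstenbergFamily F)
    (h : ∀ N : ℕ, 0 < N → ∀ S : Finset V, largeWeightSet G μ p N S ∈ F)
    (N : ℕ) (S : Finset V) : largeWeightSet G μ p N S ∈ tildeFamily F := by
  classical
  -- An empty generation has weight `0`, and positive weights occur at arbitrarily late times.
  have hne : ∀ (v : V) (k : ℕ), (descendants G k v).Nonempty := by
    intro v k
    obtain ⟨n, hn, hkn⟩ := (hF.infinite _ (h 1 one_pos {v})).exists_gt k
    rw [mem_largeWeightSet] at hn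
    exact descendants_nonempty_of_le hkn.le
      (descendants_nonempty_of_generationWeight_pos
        (zero_le.trans_lt (hn v (Finset.mem_singleton_self v))))
  choose x hx using hne
  intro L
  obtain ⟨N', hN'⟩ := exists_nat_ge
    (((N : ℝ) + 1) * (1 + ∑ k ∈ Finset.range (L + 1), ‖B ^ k‖))
  have hM : ∀ k ≤ L, ‖B ^ k‖ ≤ 1 + ∑ k ∈ Finset.range (L + 1), ‖B ^ k‖ := by
    intro k hk
    have := Finset.single_le_sum (f := fun k => ‖B ^ k‖) (fun i _ => norm_nonneg _)
      (Finset.mem_range_succ_iff.2 hk)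
    linarith
  have hM₁ : 1 ≤ 1 + ∑ k ∈ Finset.range (L + 1), ‖B ^ k‖ :=
    le_add_of_nonneg_right (Finset.sum_nonneg fun _ _ => norm_nonneg _)
  set M := 1 + ∑ k ∈ Finset.range (L + 1), ‖B ^ k‖
  have hNN' : N < N' := by
    have : (N : ℝ) + 1 ≤ N' := hN'.trans' (le_mul_of_one_le_right (by positivity) hM₁)
    exact_mod_cast this
  refine ⟨_, h N' (by lia) (S.biUnion fun v => (Finset.range (L + 1)).image (x v)), ?_⟩
  rintro m ⟨b, hb, hmb⟩
  rw [mem_largeWeightSet] at hb ⊢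
  intro v hv
  have hbv : ∀ k ≤ L, (N' : ℝ≥0∞) < generationWeight G μ p b (x v k) := fun k hk =>
    hb _ (Finset.mem_biUnion.2
      ⟨v, hv, Finset.mem_image_of_mem _ (Finset.mem_range_succ_iff.2 hk)⟩)
  rcases le_total b m with hbm | hmb'
  · obtain ⟨k, rfl⟩ := Nat.exists_eq_add_of_le hbm
    have hk : k ≤ L := by
      rw [abs_le] at hmb
      lia
    have hlt : (N : ℝ≥0∞) < N' := by exact_mod_cast hNN'
    exact hlt.trans ((hbv k hk).trans_le (generationWeight_le_add (hx v k) b))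
  · obtain ⟨k, rfl⟩ := Nat.exists_eq_add_of_le hmb'
    have hk : k ≤ L := by
      rw [abs_le] at hmb
      lia
    have hx0 : x v 0 = v := hx v 0
    have hlt := hx0 ▸ hbv 0 (Nat.zero_le L)
    refine natCast_lt_of_ofReal_add_one_le
      (hB.le_generationWeight_of_lt_add hG (by positivity) (hM k hk) (lt_of_le_of_lt ?_ hlt))
    rw [← ENNReal.ofReal_natCast N']
    exact ENNReal.ofReal_le_ofReal hN'

/-- Only upward closure of `F` is assumed, so that the result also serves for `tildeFamily F`. -/
theorem isFamilyTransitive_of_largeWeightSet_mem (hG : IsDirectedTree G) (hroot : IsRooted G)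
    (hB : IsBackwardShift G B) (hF : ∀ A ∈ F, ∀ A' : Set ℕ, A ⊆ A' → A' ∈ F)
    (h : ∀ N : ℕ, 0 < N → ∀ S : Finset V, largeWeightSet G μ p N S ∈ F) :
    IsFamilyTransitive F B := by
  classical
  intro U W hU hUne hW hWne
  obtain ⟨s, c, hf⟩ := exists_sum_single_mem hU hUne
  obtain ⟨t, d, hg⟩ := exists_sum_single_mem hW hWne
  obtain ⟨n₀, hn₀⟩ := hB.exists_pow_eq_zero hG hroot s c
  set f := ∑ u ∈ s, single μ p u (c u)
  obtain ⟨ε, hε, hball⟩ := Metric.isOpen_iff.1 hU f hf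
  obtain ⟨v₀⟩ := hG.nonempty
  -- A weight at `v₀` above `N₁` forces `n ≥ n₀`, so `F` need not be stable under removing initial
  -- segments. The vertex `v₀` is extra since `t` may be empty.
  obtain ⟨N₁, hN₁⟩ := ENNReal.exists_nat_gt
    (r := ∑ n ∈ Finset.range n₀, generationWeight G μ p n v₀)
    (ENNReal.sum_ne_top.2 fun n _ => hB.generationWeight_ne_top hG n v₀)
  obtain ⟨N₂, hN₂⟩ := exists_nat_gt ((∑ u ∈ t, ‖d u‖) / ε)
  refine hF _ (h (N₁ + N₂ + 1) (Nat.succ_pos _) (insert v₀ t)) _ fun n hn => ?_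
  rw [mem_largeWeightSet] at hn
  have hn₀n : n₀ ≤ n := by
    by_contra! hlt
    have h1 := hn v₀ (Finset.mem_insert_self _ _)
    have h2 : generationWeight G μ p n v₀ ≤ ∑ n ∈ Finset.range n₀, generationWeight G μ p n v₀ :=
      Finset.single_le_sum (f := fun n => generationWeight G μ p n v₀) (fun _ _ => zero_le)
        (Finset.mem_range.2 hlt)
    have h3 : ((N₁ + N₂ + 1 : ℕ) : ℝ≥0∞) < N₁ := h1.trans_le (h2.trans hN₁.le)
    have h4 : N₁ + N₂ + 1 < N₁ := by exact_mod_cast h3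
    lia
  have hex : ∀ u : V, ∃ k : WeightedSpace μ p, u ∈ t →
      (B ^ n) k = single μ p u 1 ∧ ((N₁ + N₂ + 1 : ℕ) : ℝ) * ‖k‖ ≤ 1 := by
    intro u
    by_cases hu : u ∈ t
    · obtain ⟨k, hk⟩ := hB.exists_pow_eq_single hG (n := n) (v := u)
        (K := ((N₁ + N₂ + 1 : ℕ) : ℝ)) (Nat.cast_nonneg _)
        (by rw [ENNReal.ofReal_natCast]; exact hn u (Finset.mem_insert_of_mem hu))
      exact ⟨k, fun _ => hk⟩
    · exact ⟨0, fun h => absurd h hu⟩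
  choose k hk using hex
  set K : ℝ := ((N₁ + N₂ + 1 : ℕ) : ℝ) with hKdef
  have hK : (0 : ℝ) < K := by positivity
  have hN₂K : (N₂ : ℝ) ≤ K := by
    rw [hKdef]
    exact_mod_cast (by lia : N₂ ≤ N₁ + N₂ + 1)
  have hnorm : ‖∑ u ∈ t, d u • k u‖ < ε := by
    calc ‖∑ u ∈ t, d u • k u‖ ≤ ∑ u ∈ t, ‖d u‖ * K⁻¹ := by
          refine norm_sum_le_of_le _ fun u hu => ?_
          rw [norm_smul]
          gcongr
          exact (le_inv_mul_iff₀ hK).2 (hk u hu).2 |>.trans_eq (mul_one _)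
      _ = (∑ u ∈ t, ‖d u‖) / K := by rw [← Finset.sum_mul, div_eq_mul_inv]
      _ < ε := by
          rw [div_lt_iff₀ hε] at hN₂
          rw [div_lt_iff₀ hK, mul_comm]
          exact hN₂.trans_le (by gcongr)
  refine ⟨∑ u ∈ t, single μ p u (d u), ⟨f + ∑ u ∈ t, d u • k u, hball ?_, ?_⟩, hg⟩
  · rw [Metric.mem_ball, dist_eq_norm, add_sub_cancel_left]
    exact hnorm
  · rw [map_add, hn₀ n hn₀n, zero_add, map_sum]
    refine Finset.sum_congr rfl fun u hu => ?_
    rw [map_smul, (hk u hu).1, smul_single_one]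

theorem largeWeightSet_mem_of_isBounded (hG : IsDirectedTree G)
    (hB : IsBackwardShift G B) (hF : ∀ A ∈ F, ∀ A' : Set ℕ, A ⊆ A' → A' ∈ F)
    {C : Set (WeightedSpace μ p)} (hC : Bornology.IsBounded C)
    (h : ∀ W : Set (WeightedSpace μ p), IsWeaklyOpen 𝕜 W → W.Nonempty → returnSet B C W ∈ F)
    (N : ℕ) (S : Finset V) : largeWeightSet G μ p N S ∈ F := by
  classical
  obtain ⟨M, hM, hCM⟩ := hC.exists_pos_norm_le
  -- A vector of norm at most `M` whose image has a coordinate above `K` witnesses a weight of at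
  -- least `N + 1`.
  set K : ℝ := (N + 1) * M with hK
  have hK₀ : 0 < K := by positivity
  refine hF _ (h _ (isWeaklyOpen_setOf_forall_lt_norm S (evalCLM μ p) K)
    ⟨∑ u ∈ S, single μ p u ((K + 1 : ℝ) : 𝕜), fun v hv => ?_⟩) _ ?_
  · rw [evalCLM_apply, sum_single_apply S (fun _ => ((K + 1 : ℝ) : 𝕜)), if_pos hv,
      RCLike.norm_of_nonneg (by positivity)]
    exact lt_add_one K
  · rintro n ⟨_, ⟨f, hf, rfl⟩, hfW⟩
    rw [mem_largeWeightSet]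
    intro v hv
    have hfv : K < ‖(B ^ n) f v‖ := hfW v hv
    refine natCast_lt_of_ofReal_add_one_le
      (hB.le_generationWeight hG (norm_pos_iff.1 (hK₀.trans hfv)) (hfv.le.trans' ?_))
    rw [hK]
    gcongr
    exact hCM f hf

theorem largeWeightSet_mem_of_recurrent (hG : IsDirectedTree G) (hroot : IsRooted G)
    (hB : IsBackwardShift G B) (hF : ∀ A ∈ F, ∀ A' : Set ℕ, A ⊆ A' → A' ∈ F)
    (hshift : ∀ A ∈ F, ∀ n : ℕ, A ∩ Set.Ici n ∈ F)
    (h : ∀ (g : WeightedSpace μ p) (U W : Set (WeightedSpace μ p)),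
      IsOpen U → g ∈ U → IsWeaklyOpen 𝕜 W → g ∈ W → returnSet B U W ∈ F)
    (N : ℕ) (S : Finset V) : largeWeightSet G μ p N S ∈ F := by
  classical
  obtain ⟨n₀, hn₀⟩ := hB.exists_pow_eq_zero hG hroot S fun _ => 1
  set g := ∑ u ∈ S, single μ p u (1 : 𝕜) with hg
  -- For `n ≥ n₀` the vector `f - g`, of norm below this radius, has the same image as `f`, with
  -- coordinates above `1 / 2` on `S`; the ratio is `N + 1`.
  have hr : (0 : ℝ) < (2 * ((N : ℝ) + 1))⁻¹ := by positivity
  have hgW : g ∈ {f | ∀ v ∈ S, 1 / 2 < ‖evalCLM μ p v f‖} := by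
    intro v hv
    rw [evalCLM_apply, hg, sum_single_apply S (fun _ => (1 : 𝕜)), if_pos hv, norm_one]
    norm_num
  refine hF _ (hshift _ (h g (Metric.ball g (2 * ((N : ℝ) + 1))⁻¹) _ Metric.isOpen_ball
    (Metric.mem_ball_self hr) (isWeaklyOpen_setOf_forall_lt_norm S (evalCLM μ p) (1 / 2))
    hgW) n₀) _ ?_
  rintro n ⟨⟨_, ⟨f, hf, rfl⟩, hfW⟩, hn⟩
  rw [mem_largeWeightSet]
  intro v hv
  have hfv : 1 / 2 < ‖(B ^ n) f v‖ := hfW v hv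
  have hfg : (B ^ n) (f - g) = (B ^ n) f := by rw [map_sub, hn₀ n hn, sub_zero]
  rw [← hfg] at hfv
  refine natCast_lt_of_ofReal_add_one_le
    (hB.le_generationWeight hG (norm_pos_iff.1 (hfv.trans' (by norm_num))) (hfv.le.trans' ?_))
  rw [Metric.mem_ball, dist_eq_norm] at hf
  calc ((N : ℝ) + 1) * ‖f - g‖ ≤ ((N : ℝ) + 1) * (2 * ((N : ℝ) + 1))⁻¹ := by gcongr
    _ = 1 / 2 := by field_simp

theorem exists_isBounded_of_isFamilyTransitive (hV : Nonempty V) (h : IsFamilyTransitive F B) :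
    ∃ C : Set (WeightedSpace μ p), Bornology.IsBounded C ∧ 0 ∉ C ∧
      ∀ W : Set (WeightedSpace μ p), IsWeaklyOpen 𝕜 W → W.Nonempty → returnSet B C W ∈ F := by
  obtain ⟨v⟩ := hV
  have hpos : 0 < ‖single μ p v 1‖ := by
    rw [norm_single, norm_one, one_mul]
    exact norm_pos_iff.2 (μ v).ne_zero
  -- With this radius `0` lies on the bounding sphere, hence outside the open ball.
  refine ⟨Metric.ball (single μ p v 1) ‖single μ p v 1‖, Metric.isBounded_ball, ?_,
    fun W hW hne => h _ W Metric.isOpen_ball ⟨_, Metric.mem_ball_self hpos⟩ hW.isOpen hne⟩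
  rw [Metric.mem_ball, dist_zero_left]
  exact lt_irrefl _

end Transitivity

end TreeShift

end

theorem mainTheorem2 {𝕜 : Type*} [RCLike 𝕜] {V : Type*} (G : Digraph V)
    (hG : IsDirectedTree G) (hroot : IsRooted G) (μ : V → 𝕜ˣ)
    (F : Set (Set ℕ)) (hF : IsFurstenbergFamily F)
    -- `WeightedSpace μ p` is `ℓ^p(V, μ)` for `1 ≤ p < ∞` and `c_0(V, μ)` for `p = ∞`
    (p : ℝ≥0∞) [Fact (1 ≤ p)]
    (B : WeightedSpace μ p →L[𝕜] WeightedSpace μ p) (hB : IsBackwardShift G B) :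
    List.TFAE [
      IsFamilyTransitive (tildeFamily F) B,
      IsFamilyTransitive F B,
      ∃ C : Set (WeightedSpace μ p), Bornology.IsBounded C ∧ 0 ∉ C ∧
        ∀ W : Set (WeightedSpace μ p), IsWeaklyOpen 𝕜 W → W.Nonempty → returnSet B C W ∈ F,
      ∀ N : ℕ, 0 < N → ∀ S : Finset V,
        (⋂ v ∈ S, {n : ℕ | (N : ℝ≥0∞) < generationWeight G μ p n v}) ∈ F] ∧
    ((∀ A ∈ F, ∀ n : ℕ, A ∩ Set.Ici n ∈ F) →
      (IsFamilyTransitive F B ↔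
        ∀ (g : WeightedSpace μ p) (U W : Set (WeightedSpace μ p)),
          IsOpen U → g ∈ U → IsWeaklyOpen 𝕜 W → g ∈ W → returnSet B U W ∈ F)) ∧
    ((∀ A ∈ F, ∀ A' ∈ F, A ∩ A' ∈ F) →
      (IsFamilyTransitive F B ↔
        ∀ N : ℕ, 0 < N → ∀ v : V, {n : ℕ | (N : ℝ≥0∞) < generationWeight G μ p n v} ∈ F)) := by
  have h23 := exists_isBounded_of_isFamilyTransitive (F := F) (B := B) hG.nonempty
  have h42 := isFamilyTransitive_of_largeWeightSet_mem (F := F) hG hroot hB hF.mono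
  have h24 : IsFamilyTransitive F B → ∀ (N : ℕ) (S : Finset V),
      largeWeightSet G μ p N S ∈ F := fun h =>
    let ⟨_, hC, _, hCW⟩ := h23 h
    largeWeightSet_mem_of_isBounded hG hB hF.mono hC hCW
  refine ⟨?_, fun hshift => ⟨fun h g U W hU hgU hW hgW => h U W hU ⟨g, hgU⟩ hW.isOpen ⟨g, hgW⟩,
    fun h => h42 fun N _ S => largeWeightSet_mem_of_recurrent hG hroot hB hF.mono hshift h N S⟩,
    fun hinter => ⟨fun h N _ v => ?_, fun h => h42 fun N hN S =>
      largeWeightSet_mem_of_inter_mem hF hinter (h N hN) S⟩⟩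
  · tfae_have 1 → 2 := fun h U W hU hU' hW hW' =>
      hF.tildeFamily_subset (h U W hU hU' hW hW')
    tfae_have 2 → 3 := h23
    tfae_have 3 → 4 := fun ⟨_, hC, _, hCW⟩ N _ S =>
      largeWeightSet_mem_of_isBounded hG hB hF.mono hC hCW N S
    tfae_have 4 → 1 := fun h => isFamilyTransitive_of_largeWeightSet_mem hG hroot hB
      (fun _ hA _ hAA' => mem_tildeFamily_of_subset hA hAA')
      fun N _ S => largeWeightSet_mem_tildeFamily hG hB hF h N S
    tfae_finish
  · simpa [largeWeightSet] using h24 h N {v}
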